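/- Consider $n\ge 1$ agents (more precisely, $n$ pairs of agents, one of each pair in each of two completely identical subnetworks), nonempty closed convex sets $X\subseteq\mathbb{R}^{m_1}$, $Y\subseteq\mathbb{R}^{m_2}$, and functions $f_1,\dots,f_n:\mathbb{R}^{m_1}\times\mathbb{R}^{m_2}\to\mathbb{R}$, each strictly convex in its first and strictly concave in its second argument. A saddle point of $\phi$ on $X\times Y$ is a pair $(x^*,y^*)\in X\times Y$ with $\phi(x^*,y)\le\phi(x^*,y^*)\le\phi(x,y^*)$ for all $x\in X$, $y\in Y$. Suppose that (A1) for every $\mu\in\mathbb{R}^n$ with $\mu_i\ge 0$ and $\sum_i\mu_i=1$, the function $\sum_i\mu_if_i$ has at least one saddle point on $X\times Y$; (A4) there is $L>0$ with $|q|\le L$ for all $i$, all $(x,y)\in X\times Y$ and all $q\in\partial_xf_i(x,y)\cup\partial_yf_i(x,y)$ (the subdifferential of the convex function $f_i(\cdot,y)$ at $x$ and that of the concave function $f_i(x,\cdot)$ at $y$); (A5) the stepsizes $\gamma_k>0$, $k=0,1,\dots$, are non-increasing with $\sum_k\gamma_k=\infty$ and $\sum_k\gamma_k^2<\infty$. A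 switching digraph sequence consists of weighted digraphs on $\{1,\dots,n\}$ with self-loops, one for each time $k\ge 0$, with weights $a_{ij}(k)\ge 0$, where $a_{ij}(k)>0$ if and only if $(j,i)$ is an arc at time $k$. It satisfies the weight rule (A3) if there is $0<\eta<1$ such that $a_{ij}(k)\ge\eta$ for all $k$ and all arcs $(j,i)$ at time $k$, and $\sum_ja_{ij}(k)=1$ for all $i,k$. It is uniformly jointly strongly connected (UJSC) if there is an integer $T>0$ such that for every $k\ge 0$ the union of the digraphs at the times $k,\dots,k+T-1$ is strongly connected. Along such a sequence, with $P_X$, $P_Y$ the Euclidean projections, consider the algorithm $$x_i(k+1)=P_X\big(\hat x_i(k)-\gamma_kq_{1i}(k)\big),\qquad y_i(k+1)=P_Y\big(\hat y_i(k)+\gamma_kq_{2i}(k)\big),\qquad i=1,\dots,n,$$ where $\hat x_i(k)=\sum_ja_{ij}(k)x_j(k)$, $\hat y_i(k)=\sum_ja_{ij}(k)y_j(k)$, $q_{1i}(k)\in\partial_xf_i(\hat x_i(k),y_i(k))$ and $q_{2i}(k)\in\partial_yf_i(x_i(k),\hat y_i(k))$. The network achieves a Nash equilibrium if for all initial states $x_i(0)\in\mathbb{R}^{m_1}$,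 $y_i(0)\in\mathbb{R}^{m_2}$ (and all choices of the subgradients) there is a saddle point $(x^*,y^*)$ of $\sum_{i=1}^nf_i$ on $X\times Y$ such that $\lim_{k\to\infty}x_i(k)=x^*$ and $\lim_{k\to\infty}y_i(k)=y^*$ for all $i$. Then the network achieves a Nash equilibrium by this algorithm for every UJSC switching digraph sequence that satisfies the weight rule if and only if $f_1,\dots,f_n$ have the same saddle point on $X\times Y$. -/

import Mathlib

open Filter Topology

/-- `p` is the metric projection `P_K(z)` of `z` onto `K`: a point of `K` at which the infimum of
the distances from `z` to the points of `K` is attained. -/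
def IsProj {E : Type*} [NormedAddCommGroup E] (K : Set E) (z p : E) : Prop :=
  p ∈ K ∧ ‖z - p‖ = ⨅ w : K, ‖z - w‖

/-- On a nonempty closed convex set of a Euclidean space every point has exactly one metric
projection, so that the relation `IsProj K` is the graph of the operator `P_K`. -/
theorem existsUnique_isProj {m : ℕ} {K : Set (EuclideanSpace ℝ (Fin m))} (hne : K.Nonempty)
    (hcl : IsClosed K) (hcv : Convex ℝ K) (z : EuclideanSpace ℝ (Fin m)) :
    ∃! p, IsProj K z p := by
  obtain ⟨p, hp, hpe⟩ := exists_norm_eq_iInf_of_complete_convex hne hcl.isComplete hcv z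
  refine ⟨p, ⟨hp, hpe⟩, ?_⟩
  rintro q ⟨hq, hqe⟩
  have h1 := (norm_eq_iInf_iff_real_inner_le_zero hcv hp).1 hpe q hq
  have h2 := (norm_eq_iInf_iff_real_inner_le_zero hcv hq).1 hqe p hp
  have h3 : inner ℝ (q - p) (q - p) ≤ 0 := by
    have e : inner ℝ (q - p) (q - p) = inner ℝ (z - p) (q - p) + inner ℝ (z - q) (p - q) := by
      rw [← neg_sub q p, inner_neg_right, ← sub_eq_add_neg, ← inner_sub_left]
      congr 1
      abel
    linarith
  exact sub_eq_zero.1 (inner_self_eq_zero.1 (le_antisymm h3 real_inner_self_nonneg))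

/-- The subdifferential of a convex function `φ` at `z₀`. -/
def subdiffConvex {E : Type*} [NormedAddCommGroup E] [InnerProductSpace ℝ E]
    (φ : E → ℝ) (z₀ : E) : Set E :=
  {v | ∀ z, φ z₀ + inner ℝ (z - z₀) v ≤ φ z}

/-- The subdifferential of a concave function `φ` at `z₀`. -/
def subdiffConcave {E : Type*} [NormedAddCommGroup E] [InnerProductSpace ℝ E]
    (φ : E → ℝ) (z₀ : E) : Set E :=
  {v | ∀ z, φ z ≤ φ z₀ + inner ℝ (z - z₀) v}

/-- `φ` is strictly convex-concave on the whole space: strictly convex in the first argument and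
strictly concave in the second one. -/
def StrictlyConvexConcave {E F : Type*} [NormedAddCommGroup E] [NormedSpace ℝ E]
    [NormedAddCommGroup F] [NormedSpace ℝ F] (φ : E → F → ℝ) : Prop :=
  (∀ y, StrictConvexOn ℝ Set.univ fun x => φ x y) ∧
    ∀ x, StrictConcaveOn ℝ Set.univ fun y => φ x y

/-- `(a, b) ∈ X × Y` is a saddle point of `φ` on `X × Y`:
`φ a y ≤ φ a b ≤ φ x b` for all `x ∈ X` and `y ∈ Y`. -/
def IsSaddle {E F : Type*} (X : Set E) (Y : Set F) (φ : E → F → ℝ) (a : E) (b : F) : Prop :=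
  a ∈ X ∧ b ∈ Y ∧ (∀ y ∈ Y, φ a y ≤ φ a b) ∧ ∀ x ∈ X, φ a b ≤ φ x b

/-- A weighted digraph with self-loops on the nodes `Fin n`, given by its adjacency matrix:
the entry `weight i j` is positive if and only if `(j, i)` is an arc, and it is zero otherwise. -/
structure WeightedDigraph (n : ℕ) where
  weight : Matrix (Fin n) (Fin n) ℝ
  weight_nonneg : ∀ i j, 0 ≤ weight i j
  self_loop : ∀ i, 0 < weight i i

/-- `(j, i)` is an arc of the digraph, i.e. `j` is a neighbor of `i`. -/
def WeightedDigraph.Arc {n : ℕ} (G : WeightedDigraph n) (j i : Fin n) : Prop :=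
  0 < G.weight i j

/-- The arcs of the union over the times `k₁ ≤ s < k₂` of a switching digraph sequence. -/
def UnionArc {n : ℕ} (G : ℕ → WeightedDigraph n) (k₁ k₂ : ℕ) (j i : Fin n) : Prop :=
  ∃ s, k₁ ≤ s ∧ s < k₂ ∧ (G s).Arc j i

/-- The digraph with the given arcs is strongly connected: there is a directed path from every
node to every node. -/
def StronglyConnected {n : ℕ} (arc : Fin n → Fin n → Prop) : Prop :=
  ∀ i j, Relation.ReflTransGen arc i j

/-- The switching digraph sequence is uniformly jointly strongly connected. -/
def UJSC {n : ℕ} (G : ℕ → WeightedDigraph n) : Prop :=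
  ∃ T : ℕ, 0 < T ∧ ∀ k, StronglyConnected (UnionArc G k (k + T))

/-- The weight rule: the weights of all arcs at all times have a common lower bound `η ∈ (0, 1)`,
and the weights of the arcs that enter a node sum up to one. -/
def WeightRule {n : ℕ} (G : ℕ → WeightedDigraph n) : Prop :=
  (∃ η : ℝ, 0 < η ∧ η < 1 ∧ ∀ k i j, (G k).Arc j i → η ≤ (G k).weight i j) ∧
    ∀ k i, ∑ j, (G k).weight i j = 1

/-- The rule for the homogeneous stepsizes. -/
def StepsizeRule (γ : ℕ → ℝ) : Prop :=
  (∀ k, 0 < γ k) ∧ Antitone γ ∧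
    Tendsto (fun N => ∑ k ∈ Finset.range N, γ k) atTop atTop ∧
    Summable fun k => γ k ^ 2

/-- Every weighted average of the functions `f i`, with a stochastic weight vector, has a saddle
point on `X × Y`. -/
def SaddlePointsExist {E F : Type*} {n : ℕ} (X : Set E) (Y : Set F)
    (f : Fin n → E → F → ℝ) : Prop :=
  ∀ μ ∈ stdSimplex ℝ (Fin n), ∃ a b, IsSaddle X Y (fun x y => ∑ i, μ i * f i x y) a b

/-- The subgradients of all `f i` at all points of `X × Y` are bounded by a common constant. -/
def BoundedSubgradients {E F : Type*} [NormedAddCommGroup E] [InnerProductSpace ℝ E]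
    [NormedAddCommGroup F] [InnerProductSpace ℝ F] {n : ℕ} (X : Set E) (Y : Set F)
    (f : Fin n → E → F → ℝ) : Prop :=
  ∃ L : ℝ, 0 < L ∧ ∀ i, ∀ x ∈ X, ∀ y ∈ Y,
    (∀ q ∈ subdiffConvex (fun x' => f i x' y) x, ‖q‖ ≤ L) ∧
      ∀ q ∈ subdiffConcave (fun y' => f i x y') y, ‖q‖ ≤ L

/-- `(x k i, y k i)`, the states of the pair of agents `i` at time `k`, evolve by the homogeneous
projected subgradient algorithm with stepsizes `γ`, along the switching digraphs `G`, for some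
choice of the subgradients. The initial states are arbitrary points of the whole spaces. -/
def IsTrajectory {E F : Type*} [NormedAddCommGroup E] [InnerProductSpace ℝ E]
    [NormedAddCommGroup F] [InnerProductSpace ℝ F] {n : ℕ} (X : Set E) (Y : Set F)
    (f : Fin n → E → F → ℝ) (G : ℕ → WeightedDigraph n) (γ : ℕ → ℝ)
    (x : ℕ → Fin n → E) (y : ℕ → Fin n → F) : Prop :=
  ∀ k i,
    (∃ q ∈ subdiffConvex (fun x' => f i x' (y k i)) (∑ j, (G k).weight i j • x k j),
      IsProj X ((∑ j, (G k).weight i j • x k j) - γ k • q) (x (k + 1) i)) ∧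
    ∃ q ∈ subdiffConcave (fun y' => f i (x k i) y') (∑ j, (G k).weight i j • y k j),
      IsProj Y ((∑ j, (G k).weight i j • y k j) + γ k • q) (y (k + 1) i)

/-- The network achieves a Nash equilibrium: from all initial states (and for all choices of the
subgradients), the states of all agents of the first subnetwork converge to a common point `a` and
those of the second one to a common point `b`, where `(a, b)` is a saddle point on `X × Y` of the
sum `U` of the objective functions, i.e. a Nash equilibrium of the zero-sum game. -/
def AchievesNash {E F : Type*} [NormedAddCommGroup E] [InnerProductSpace ℝ E]
    [NormedAddCommGroup F] [InnerProductSpace ℝ F] {n : ℕ} (X : Set E) (Y : Set F)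
    (f : Fin n → E → F → ℝ) (G : ℕ → WeightedDigraph n) (γ : ℕ → ℝ) : Prop :=
  ∀ (x : ℕ → Fin n → E) (y : ℕ → Fin n → F), IsTrajectory X Y f G γ x y →
    ∃ a b, IsSaddle X Y (fun x' y' => ∑ i, f i x' y') a b ∧
      (∀ i, Tendsto (fun k => x k i) atTop (𝓝 a)) ∧
      ∀ i, Tendsto (fun k => y k i) atTop (𝓝 b)

/-! Sufficiency. Let `(a, b)` be a saddle point of every `f i`. The Lyapunov function is the maximum
over the agents of `‖x k i - a‖ ^ 2 + ‖y k i - b‖ ^ 2`: averaging with row-stochastic weights cannot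
increase a maximum, so the digraphs need not be weight-balanced. Each agent's step contributes a
decrease of `2 * γ k` times the gap `f i (x k i) b - f i a (y k i)`, nonnegative because `(a, b)` is
a saddle point of that very `f i`, up to errors of the order of `γ k ^ 2` and of the squared
disagreements (`IsTrajectory.norm_sub_sq_add_le`). These errors are summable, since long products of
weight matrices contract disagreements (`summable_disagreement_sq`). Hence the maximum converges.
With a positive limit, vanishing disagreement would keep every agent pair away from `(a, b)`, the
gaps would stay bounded below (`IsSaddle.exists_gap`), and the divergence of `∑ γ k` would drive the
maximum below zero.

Necessity. For a positive stochastic vector `μ`, take the constant complete digraph all of whose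
rows are `μ`. Since `μ` is invariant, `∑ i, μ i * ‖x k i - w‖ ^ 2` shows that a consensus limit is a
saddle point of `∑ i, μ i * f i` (`IsTrajectory.sum_mul_le_of_tendsto`). Achieving a Nash
equilibrium forces this limit to be the unique saddle point of `∑ i, f i`, whatever `μ` is. Letting
`μ` tend to the unit vectors isolates each `f i`. -/

theorem Relation.ReflTransGen.exists_crossing {α : Type*} {r : α → α → Prop} {p : α → Prop}
    {a b : α} (h : Relation.ReflTransGen r a b) (ha : p a) (hb : ¬ p b) :
    ∃ u v, r u v ∧ p u ∧ ¬ p v := by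
  induction h with
  | refl => exact absurd ha hb
  | tail _ hbc ih =>
    rename_i b c _
    by_cases hp : p b
    · exact ⟨b, c, hbc, hp, hb⟩
    · exact ih hp

/-! ### Products of weight matrices and their uniform positivity -/

section Transition

variable {n : ℕ}

/-- The product of the weight matrices at the times `s, …, s + t - 1`. -/
def transitionMatrix (G : ℕ → WeightedDigraph n) (s : ℕ) : ℕ → Matrix (Fin n) (Fin n) ℝ
  | 0 => 1
  | t + 1 => (G (s + t)).weight * transitionMatrix G s t

theorem transitionMatrix_nonneg (G : ℕ → WeightedDigraph n) (s t : ℕ) (i j : Fin n) :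
    0 ≤ transitionMatrix G s t i j := by
  induction t generalizing i with
  | zero =>
    rw [transitionMatrix, Matrix.one_apply]
    split_ifs <;> norm_num
  | succ t ih =>
    rw [transitionMatrix, Matrix.mul_apply]
    exact Finset.sum_nonneg fun l _ => mul_nonneg ((G _).weight_nonneg _ _) (ih l)

theorem transitionMatrix_row_sum {G : ℕ → WeightedDigraph n} (hG : WeightRule G) (s t : ℕ)
    (i : Fin n) : ∑ j, transitionMatrix G s t i j = 1 := by
  induction t generalizing i with
  | zero => simp [transitionMatrix, Matrix.one_apply]
  | succ t ih =>
    simp only [transitionMatrix, Matrix.mul_apply]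
    rw [Finset.sum_comm]
    simp [← Finset.mul_sum, ih, hG.2]

theorem pow_succ_le_transitionMatrix {G : ℕ → WeightedDigraph n} {η : ℝ} (hη : 0 < η)
    (hGη : ∀ k i j, (G k).Arc j i → η ≤ (G k).weight i j) {s t : ℕ} {i j l : Fin n}
    (harc : (G (s + t)).Arc l i) (h : η ^ t ≤ transitionMatrix G s t l j) :
    η ^ (t + 1) ≤ transitionMatrix G s (t + 1) i j := by
  rw [transitionMatrix, Matrix.mul_apply, pow_succ']
  refine le_trans (mul_le_mul (hGη _ _ _ harc) h (by positivity) ((G _).weight_nonneg _ _)) ?_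
  exact Finset.single_le_sum (f := fun l => (G (s + t)).weight i l * transitionMatrix G s t l j)
    (fun m _ => mul_nonneg ((G _).weight_nonneg _ _) (transitionMatrix_nonneg G s t m j))
    (Finset.mem_univ l)

theorem pow_add_le_transitionMatrix {G : ℕ → WeightedDigraph n} {η : ℝ} (hη : 0 < η)
    (hGη : ∀ k i j, (G k).Arc j i → η ≤ (G k).weight i j) {s t : ℕ} {i j : Fin n}
    (h : η ^ t ≤ transitionMatrix G s t i j) (r : ℕ) :
    η ^ (t + r) ≤ transitionMatrix G s (t + r) i j := by
  induction r with
  | zero => exact h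
  | succ r ih => exact pow_succ_le_transitionMatrix hη hGη ((G _).self_loop i) ih

/-- Fix a column `j` and follow the set of rows whose entry is at least `η ^ t`. Self-loops keep it
from losing nodes. While it is proper, joint connectivity gives an arc leaving it within the next
`T` steps, so it gains a node per window and is full after `n` windows. -/
theorem exists_forall_le_transitionMatrix {G : ℕ → WeightedDigraph n} (hU : UJSC G)
    (hG : WeightRule G) :
    ∃ B : ℕ, ∃ δ : ℝ, 0 < δ ∧ ∀ s i j, δ ≤ transitionMatrix G s B i j := by
  obtain ⟨T, -, hT⟩ := hU
  obtain ⟨⟨η, hη, -, hGη⟩, -⟩ := hG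
  refine ⟨n * T, η ^ (n * T), by positivity, fun s i j => ?_⟩
  let S : ℕ → Finset (Fin n) := fun t =>
    Finset.univ.filter fun i => η ^ t ≤ transitionMatrix G s t i j
  have hmono : ∀ t r, S t ⊆ S (t + r) := by
    intro t r i hi
    simp only [S, Finset.mem_filter, Finset.mem_univ, true_and] at hi ⊢
    exact pow_add_le_transitionMatrix hη hGη hi r
  have h0 : j ∈ S 0 := by simp [S, transitionMatrix]
  have hgrow : ∀ t, j ∈ S t → S t ≠ Finset.univ → (S t).card < (S (t + T)).card := by
    intro t hj hne
    obtain ⟨i, hi⟩ : ∃ i, i ∉ S t := by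
      by_contra! h
      exact hne (Finset.eq_univ_iff_forall.2 h)
    obtain ⟨u, v, ⟨τ, hτ1, hτ2, harc⟩, hu, hv⟩ :=
      (hT (s + t) j i).exists_crossing (p := fun i => i ∈ S t) hj hi
    obtain ⟨r, rfl⟩ : ∃ r, τ = s + (t + r) := ⟨τ - (s + t), by omega⟩
    have hv' : v ∈ S (t + r + 1) := by
      have hu' := hmono t r hu
      simp only [S, Finset.mem_filter, Finset.mem_univ, true_and] at hu' ⊢
      exact pow_succ_le_transitionMatrix hη hGη harc hu'
    have hv2 : v ∈ S (t + T) := by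
      have := hmono (t + r + 1) (T - (r + 1)) hv'
      rwa [show t + r + 1 + (T - (r + 1)) = t + T by omega] at this
    exact Finset.card_lt_card ⟨hmono t T, fun h => hv (h hv2)⟩
  have hcard : ∀ m, S (m * T) = Finset.univ ∨ m < (S (m * T)).card := by
    intro m
    induction m with
    | zero => right; rw [Nat.zero_mul]; exact Finset.card_pos.2 ⟨j, h0⟩
    | succ m ih =>
      rw [Nat.succ_mul]
      by_cases h : S (m * T) = Finset.univ
      · left
        exact Finset.eq_univ_iff_forall.2 fun x => hmono _ _ (h ▸ Finset.mem_univ x)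
      · right
        have hj : j ∈ S (m * T) := by simpa using hmono 0 (m * T) h0
        have := hgrow _ hj h
        have := ih.resolve_left h
        omega
  have huniv : S (n * T) = Finset.univ := by
    refine (hcard n).resolve_right fun h => ?_
    have := Finset.card_le_univ (S (n * T))
    simp at this
    omega
  have hi : i ∈ S (n * T) := huniv ▸ Finset.mem_univ i
  simpa [S] using hi

end Transition

/-! ### Contraction and square-summability of the disagreement -/

section Disagreement

variable {n : ℕ} {E : Type*} [NormedAddCommGroup E]

/-- The largest distance between two of the vectors `z i`. -/
noncomputable def disagreement (z : Fin n → E) : ℝ := ‖fun p : Fin n × Fin n => z p.1 - z p.2‖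

theorem disagreement_nonneg (z : Fin n → E) : 0 ≤ disagreement z := norm_nonneg _

theorem norm_sub_le_disagreement (z : Fin n → E) (i j : Fin n) :
    ‖z i - z j‖ ≤ disagreement z :=
  norm_le_pi_norm (fun p : Fin n × Fin n => z p.1 - z p.2) (i, j)

theorem disagreement_le {z : Fin n → E} {r : ℝ} (hr : 0 ≤ r) (h : ∀ i j, ‖z i - z j‖ ≤ r) :
    disagreement z ≤ r :=
  (pi_norm_le_iff_of_nonneg hr).2 fun p => h p.1 p.2

theorem norm_sub_sq_sub_norm_sub_sq_le (z : Fin n → E) (a : E) {R : ℝ}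
    (hR : ∀ i, ‖z i - a‖ ≤ R) (i j : Fin n) :
    ‖z j - a‖ ^ 2 - ‖z i - a‖ ^ 2 ≤ 2 * R * disagreement z := by
  have h1 := norm_sub_norm_le (z j - a) (z i - a)
  rw [sub_sub_sub_cancel_right] at h1
  have h2 := h1.trans (norm_sub_le_disagreement z j i)
  have h3 := mul_le_mul_of_nonneg_right h2
    (add_nonneg (norm_nonneg (z j - a)) (norm_nonneg (z i - a)))
  have h4 := mul_le_mul_of_nonneg_left (add_le_add (hR j) (hR i)) (disagreement_nonneg z)
  nlinarith

variable [NormedSpace ℝ E]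

theorem norm_sum_smul_sub_le_disagreement {w : Fin n → ℝ} (hw : ∀ j, 0 ≤ w j)
    (hw1 : ∑ j, w j = 1) (z : Fin n → E) (i : Fin n) :
    ‖(∑ j, w j • z j) - z i‖ ≤ disagreement z := by
  have e : (∑ j, w j • z j) - z i = ∑ j, w j • (z j - z i) := by
    simp [smul_sub, Finset.sum_sub_distrib, ← Finset.sum_smul, hw1]
  rw [e]
  calc ‖∑ j, w j • (z j - z i)‖ ≤ ∑ j, w j * disagreement z := by
        refine norm_sum_le_of_le _ fun j _ => ?_
        rw [norm_smul, Real.norm_of_nonneg (hw j)]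
        exact mul_le_mul_of_nonneg_left (norm_sub_le_disagreement z j i) (hw j)
    _ = disagreement z := by rw [← Finset.sum_mul, hw1, one_mul]

/-- The product coupling of two weight vectors of mass `c` writes `c` times the difference as a sum
of `(u i * v j) • (z i - z j)`, of total mass `c ^ 2`. -/
theorem norm_sum_smul_sub_sum_smul_le {u v : Fin n → ℝ} (hu : ∀ i, 0 ≤ u i) (hv : ∀ i, 0 ≤ v i)
    {c : ℝ} (hu1 : ∑ i, u i = c) (hv1 : ∑ i, v i = c) (z : Fin n → E) :
    ‖(∑ i, u i • z i) - ∑ i, v i • z i‖ ≤ c * disagreement z := by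
  have hc : 0 ≤ c := hu1 ▸ Finset.sum_nonneg fun i _ => hu i
  rcases hc.eq_or_lt with rfl | hc
  · have hu0 := (Finset.sum_eq_zero_iff_of_nonneg fun i _ => hu i).1 hu1
    have hv0 := (Finset.sum_eq_zero_iff_of_nonneg fun i _ => hv i).1 hv1
    simp only [Finset.mem_univ, true_imp_iff] at hu0 hv0
    simp [hu0, hv0]
  · have e : c • ((∑ i, u i • z i) - ∑ i, v i • z i)
        = ∑ i, ∑ j, (u i * v j) • (z i - z j) := by
      simp only [smul_sub, Finset.sum_sub_distrib]
      congr 1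
      · simp only [← Finset.sum_smul, ← Finset.mul_sum, hv1, Finset.smul_sum, smul_smul, mul_comm]
      · rw [Finset.sum_comm]
        simp only [← Finset.sum_smul, ← Finset.sum_mul, hu1, Finset.smul_sum, smul_smul]
    have h : ‖c • ((∑ i, u i • z i) - ∑ i, v i • z i)‖ ≤ c * (c * disagreement z) := by
      rw [e]
      calc ‖∑ i, ∑ j, (u i * v j) • (z i - z j)‖
          ≤ ∑ i, ∑ j, (u i * v j) * disagreement z := by
            refine norm_sum_le_of_le _ fun i _ => norm_sum_le_of_le _ fun j _ => ?_
            have := mul_nonneg (hu i) (hv j)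
            rw [norm_smul, Real.norm_of_nonneg this]
            exact mul_le_mul_of_nonneg_left (norm_sub_le_disagreement z i j) this
        _ = c * (c * disagreement z) := by
            simp only [← Finset.sum_mul, ← Finset.mul_sum, hv1, hu1]
            ring
    rw [norm_smul, Real.norm_of_nonneg hc.le] at h
    exact le_of_mul_le_mul_left h hc

/-- The common part `δ` of all weights cancels; only the remaining mass `1 - n * δ` sees the
disagreement. -/
theorem norm_sum_smul_sub_sum_smul_le_of_le {u v : Fin n → ℝ} {δ : ℝ} (hu : ∀ i, δ ≤ u i)
    (hv : ∀ i, δ ≤ v i) (hu1 : ∑ i, u i = 1) (hv1 : ∑ i, v i = 1) (z : Fin n → E) :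
    ‖(∑ i, u i • z i) - ∑ i, v i • z i‖ ≤ (1 - n * δ) * disagreement z := by
  have := norm_sum_smul_sub_sum_smul_le (u := fun i => u i - δ) (v := fun i => v i - δ)
    (fun i => sub_nonneg.2 (hu i)) (fun i => sub_nonneg.2 (hv i)) (c := 1 - n * δ)
    (by simp [hu1]) (by simp [hv1]) z
  simpa [sub_smul, Finset.sum_sub_distrib] using this

/-- Averaging does not amplify the accumulated error, and each step adds one perturbation, at most
`γ s` by monotonicity. -/
theorem norm_sub_transitionMatrix_le {G : ℕ → WeightedDigraph n} (hG : WeightRule G)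
    {γ : ℕ → ℝ} (hγ : Antitone γ) {z : ℕ → Fin n → E}
    (hz : ∀ k i, ‖z (k + 1) i - ∑ j, (G k).weight i j • z k j‖ ≤ γ k) (s t : ℕ) (i : Fin n) :
    ‖z (s + t) i - ∑ j, transitionMatrix G s t i j • z s j‖ ≤ t * γ s := by
  induction t generalizing i with
  | zero => simp [transitionMatrix, Matrix.one_apply]
  | succ t ih =>
    have e : z (s + (t + 1)) i - ∑ j, transitionMatrix G s (t + 1) i j • z s j
        = (z (s + t + 1) i - ∑ l, (G (s + t)).weight i l • z (s + t) l)
          + ∑ l, (G (s + t)).weight i l •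
            (z (s + t) l - ∑ j, transitionMatrix G s t l j • z s j) := by
      simp only [transitionMatrix, Matrix.mul_apply, Finset.sum_smul, smul_sub,
        Finset.sum_sub_distrib, Finset.smul_sum, smul_smul]
      rw [Finset.sum_comm, ← add_assoc s t 1]
      abel
    rw [e]
    refine (norm_add_le _ _).trans ?_
    have h1 := (hz (s + t) i).trans (hγ (Nat.le_add_right s t))
    have h2 : ‖∑ l, (G (s + t)).weight i l •
            (z (s + t) l - ∑ j, transitionMatrix G s t l j • z s j)‖ ≤ t * γ s := by
      calc _ ≤ ∑ l, (G (s + t)).weight i l * (t * γ s) := by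
            refine norm_sum_le_of_le _ fun l _ => ?_
            have := (G (s + t)).weight_nonneg i l
            rw [norm_smul, Real.norm_of_nonneg this]
            exact mul_le_mul_of_nonneg_left (ih l) this
        _ = t * γ s := by rw [← Finset.sum_mul, hG.2, one_mul]
    push_cast
    linarith

/-- Summing the recursion over `k < N` gives `(1 - ρ) * ∑ u k ≤ ∑ k < B, u k + ∑' k, v k`, uniformly
in `N`. -/
theorem summable_of_add_le_mul_add {u v : ℕ → ℝ} {ρ : ℝ} {B : ℕ} (hu : ∀ k, 0 ≤ u k)
    (hv0 : ∀ k, 0 ≤ v k) (hv : Summable v) (hρ : ρ < 1)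
    (h : ∀ k, u (k + B) ≤ ρ * u k + v k) : Summable u := by
  refine summable_of_sum_range_le (c := (∑ k ∈ Finset.range B, u k + ∑' k, v k) / (1 - ρ)) hu
    fun N => ?_
  rw [le_div_iff₀ (by linarith)]
  have h1 : ∑ k ∈ Finset.range N, u k ≤ ∑ k ∈ Finset.range (B + N), u k :=
    Finset.sum_le_sum_of_subset_of_nonneg (Finset.range_mono (Nat.le_add_left _ _))
      fun i _ _ => hu i
  have h2 : ∑ k ∈ Finset.range N, u (B + k) ≤ ∑ k ∈ Finset.range N, (ρ * u k + v k) :=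
    Finset.sum_le_sum fun k _ => by rw [add_comm]; exact h k
  have h3 := hv.sum_le_tsum (Finset.range N) fun i _ => hv0 i
  rw [Finset.sum_range_add] at h1
  rw [Finset.sum_add_distrib, ← Finset.mul_sum] at h2
  linarith

/-- Perturbed averaging along a uniformly jointly strongly connected sequence of digraphs: if the
perturbations are square-summable, so are the disagreements. -/
theorem summable_disagreement_sq {G : ℕ → WeightedDigraph n} (hU : UJSC G) (hG : WeightRule G)
    {γ : ℕ → ℝ} (hγ : Antitone γ) (hγ0 : ∀ k, 0 ≤ γ k) (hγ2 : Summable fun k => γ k ^ 2)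
    {z : ℕ → Fin n → E}
    (hz : ∀ k i, ‖z (k + 1) i - ∑ j, (G k).weight i j • z k j‖ ≤ γ k) :
    Summable fun k => disagreement (z k) ^ 2 := by
  rcases Nat.eq_zero_or_pos n with rfl | hn
  · have : ∀ k, disagreement (z k) = 0 := fun k =>
      le_antisymm (disagreement_le le_rfl fun i => i.elim0) (disagreement_nonneg _)
    simp [this, summable_zero]
  obtain ⟨B, δ, hδ, hB⟩ := exists_forall_le_transitionMatrix hU hG
  set ρ : ℝ := 1 - n * δ with hρdef
  have hn' : (0 : ℝ) < n := Nat.cast_pos.2 hn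
  have hρ1 : ρ < 1 := by rw [hρdef]; nlinarith
  -- A row of sum one has `n` entries, each at least `δ`.
  have hρ0 : 0 ≤ ρ := by
    have h := Finset.sum_le_sum fun j (_ : j ∈ Finset.univ) => hB 0 ⟨0, hn⟩ j
    rw [transitionMatrix_row_sum hG] at h
    simp at h
    linarith
  have hstep : ∀ s, disagreement (z (s + B)) ≤ ρ * disagreement (z s) + 2 * (B * γ s) := by
    intro s
    refine disagreement_le (add_nonneg (mul_nonneg hρ0 (disagreement_nonneg _))
      (mul_nonneg zero_le_two (mul_nonneg (Nat.cast_nonneg _) (hγ0 s)))) fun i j => ?_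
    have h1 := norm_sub_transitionMatrix_le hG hγ hz s B i
    have h2 := norm_sub_transitionMatrix_le hG hγ hz s B j
    have h3 := norm_sum_smul_sub_sum_smul_le_of_le (hB s i) (hB s j)
      (transitionMatrix_row_sum hG s B i) (transitionMatrix_row_sum hG s B j) (z s)
    rw [norm_sub_rev] at h2
    have h4 := norm_add₃_le (a := z (s + B) i - ∑ l, transitionMatrix G s B i l • z s l)
      (b := (∑ l, transitionMatrix G s B i l • z s l) - ∑ l, transitionMatrix G s B j l • z s l)
      (c := (∑ l, transitionMatrix G s B j l • z s l) - z (s + B) j)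
    rw [sub_add_sub_cancel, sub_add_sub_cancel] at h4
    linarith
  -- Convexity of the square with weights `ρ` and `1 - ρ` gives `(ρ * d + e) ^ 2 ≤ ρ * d ^ 2 + e ^ 2
  -- / (1 - ρ)`; here `e = 2 * (B * γ k)`.
  refine summable_of_add_le_mul_add (v := fun k => (2 * B) ^ 2 / (1 - ρ) * γ k ^ 2)
    (fun k => sq_nonneg _) (fun k => ?_) (hγ2.mul_left _) hρ1 (fun k => ?_) (B := B)
  · have : 0 < 1 - ρ := by linarith
    positivity
  · have h0 : 0 < 1 - ρ := by linarith
    refine (pow_le_pow_left₀ (disagreement_nonneg _) (hstep k) 2).trans ?_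
    set d := disagreement (z k)
    rw [div_mul_eq_mul_div, ← sub_le_iff_le_add', le_div_iff₀ h0]
    nlinarith [mul_nonneg hρ0 (sq_nonneg ((1 - ρ) * d - 2 * (B * γ k)))]

end Disagreement

/-! ### Existence of subgradients and the Lipschitz bound they give -/

section Subgradient

variable {E : Type*} [NormedAddCommGroup E] [InnerProductSpace ℝ E]

theorem mem_subdiffConcave_iff_neg_mem {φ : E → ℝ} {z q : E} :
    q ∈ subdiffConcave φ z ↔ -q ∈ subdiffConvex (fun w => -φ w) z := by
  refine forall_congr' fun w => ?_
  rw [inner_neg_right]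
  constructor <;> intro h <;> linarith

/-- Hahn–Banach separates `(z₀, φ z₀)` from the strict epigraph, open because `φ` is continuous in
finite dimension. The separating functional has a positive vertical coefficient `c`, and dividing by
it gives the slope. -/
theorem ConvexOn.subdiffConvex_nonempty [FiniteDimensional ℝ E] {φ : E → ℝ}
    (hφ : ConvexOn ℝ Set.univ φ) (z₀ : E) : (subdiffConvex φ z₀).Nonempty := by
  have hcont : Continuous φ := hφ.locallyLipschitz.continuous
  have hconv : Convex ℝ {p : E × ℝ | φ p.1 < p.2} := by
    simpa using hφ.convex_strict_epigraph
  have hopen : IsOpen {p : E × ℝ | φ p.1 < p.2} :=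
    isOpen_lt (hcont.comp continuous_fst) continuous_snd
  obtain ⟨l, hl⟩ := geometric_hahn_banach_point_open (x := (z₀, φ z₀)) hconv hopen (by simp)
  set u : StrongDual ℝ E := l.comp (ContinuousLinearMap.inl ℝ E ℝ) with hu
  set c : ℝ := l (0, 1) with hc
  have hdecomp : ∀ z t, l (z, t) = u z + t * c := by
    intro z t
    have e : ((z, t) : E × ℝ) = (z, 0) + t • (0, 1) := by simp
    rw [e, map_add, map_smul, smul_eq_mul]
    simp [hu, hc]
  have hcpos : 0 < c := by
    have := hl (z₀, φ z₀ + 1) (by simp)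
    rw [hdecomp, hdecomp] at this
    linarith
  have hle : ∀ z, u z₀ + φ z₀ * c ≤ u z + φ z * c := by
    intro z
    refine le_of_forall_pos_le_add fun ε hε => ?_
    have := hl (z, φ z + ε / c) (by simp; positivity)
    rw [hdecomp, hdecomp, add_mul, div_mul_cancel₀ _ hcpos.ne'] at this
    linarith
  have : CompleteSpace E := FiniteDimensional.complete ℝ E
  refine ⟨-c⁻¹ • (InnerProductSpace.toDual ℝ E).symm u, fun z => ?_⟩
  rw [inner_smul_right, real_inner_comm, InnerProductSpace.toDual_symm_apply, map_sub]
  have h := mul_le_mul_of_nonneg_left (hle z) (inv_pos.2 hcpos).le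
  have e : ∀ r : ℝ, c⁻¹ * (r * c) = r := fun r => by field_simp
  rw [mul_add, mul_add, e, e] at h
  linarith

theorem ConcaveOn.subdiffConcave_nonempty [FiniteDimensional ℝ E] {φ : E → ℝ}
    (hφ : ConcaveOn ℝ Set.univ φ) (z₀ : E) : (subdiffConcave φ z₀).Nonempty := by
  obtain ⟨q, hq⟩ := hφ.neg.subdiffConvex_nonempty z₀
  exact ⟨-q, mem_subdiffConcave_iff_neg_mem.2 (by rwa [neg_neg])⟩

theorem sub_le_of_mem_subdiffConvex {φ : E → ℝ} {z w q : E} {L : ℝ}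
    (hq : q ∈ subdiffConvex φ z) (hL : ‖q‖ ≤ L) : φ z - φ w ≤ L * ‖z - w‖ := by
  have h1 := hq w
  have h2 := abs_real_inner_le_norm (w - z) q
  rw [norm_sub_rev w z] at h2
  have h3 := mul_le_mul_of_nonneg_left hL (norm_nonneg (z - w))
  have h4 := neg_abs_le (inner ℝ (w - z) q)
  linarith

end Subgradient

/-! ### One projected subgradient step -/

section Projection

variable {E : Type*} [NormedAddCommGroup E] [InnerProductSpace ℝ E] {K : Set E}

theorem IsProj.norm_sub_le (hK : Convex ℝ K) {z p w : E} (h : IsProj K z p) (hw : w ∈ K) :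
    ‖p - w‖ ≤ ‖z - w‖ := by
  have h1 := (norm_eq_iInf_iff_real_inner_le_zero hK h.1).1 h.2 w hw
  have e : z - w = (z - p) - (w - p) := by abel
  have h2 := norm_sub_sq_real (z - p) (w - p)
  rw [← e, norm_sub_rev w p] at h2
  refine le_of_sq_le_sq ?_ (norm_nonneg _)
  nlinarith [sq_nonneg ‖z - p‖]

theorem IsProj.norm_sub_le_of_step (hK : Convex ℝ K) {z p q : E} {γ L : ℝ} (hγ : 0 ≤ γ)
    (hL : ‖q‖ ≤ L) (hz : z ∈ K) (h : IsProj K (z - γ • q) p) : ‖p - z‖ ≤ L * γ := by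
  refine (h.norm_sub_le hK hz).trans ?_
  rw [sub_sub_cancel_left, norm_neg, norm_smul, Real.norm_of_nonneg hγ, mul_comm]
  exact mul_le_mul_of_nonneg_right hL hγ

theorem IsProj.norm_sub_sq_le_of_step (hK : Convex ℝ K) {φ : E → ℝ} {z p q w : E} {γ L : ℝ}
    (hγ : 0 ≤ γ) (hq : q ∈ subdiffConvex φ z) (hL : ‖q‖ ≤ L) (hw : w ∈ K)
    (h : IsProj K (z - γ • q) p) :
    ‖p - w‖ ^ 2 ≤ ‖z - w‖ ^ 2 + L ^ 2 * γ ^ 2 + 2 * γ * (φ w - φ z) := by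
  have h1 := pow_le_pow_left₀ (norm_nonneg _) (h.norm_sub_le hK hw) 2
  have e : z - γ • q - w = (z - w) - γ • q := by abel
  rw [e, norm_sub_sq_real (z - w), inner_smul_right, norm_smul, Real.norm_of_nonneg hγ] at h1
  have h2 := hq w
  have e2 : inner ℝ (w - z) q = -inner ℝ (z - w) q := by rw [← inner_neg_left, neg_sub]
  rw [e2] at h2
  have h3 := mul_le_mul_of_nonneg_left h2 hγ
  have h4 := mul_le_mul_of_nonneg_left (pow_le_pow_left₀ (norm_nonneg q) hL 2) (sq_nonneg γ)
  nlinarith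

theorem norm_sum_smul_sub_sq_le {ι : Type*} [Fintype ι] {w : ι → ℝ} (hw : ∀ j, 0 ≤ w j)
    (hw1 : ∑ j, w j = 1) (z : ι → E) (a : E) :
    ‖(∑ j, w j • z j) - a‖ ^ 2 ≤ ∑ j, w j * ‖z j - a‖ ^ 2 := by
  have hc : ConvexOn ℝ Set.univ fun v : E => ‖v‖ ^ 2 :=
    (convexOn_norm convex_univ).pow (fun _ _ => norm_nonneg _) 2
  have h := hc.map_sum_le (t := Finset.univ) (w := w) (p := fun j => z j - a)
    (fun j _ => hw j) hw1 fun j _ => Set.mem_univ _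
  have e : ∑ j, w j • (z j - a) = (∑ j, w j • z j) - a := by
    simp [smul_sub, Finset.sum_sub_distrib, ← Finset.sum_smul, hw1]
  simpa [e] using h

theorem IsProj.norm_sub_sq_le_of_average_step (hK : Convex ℝ K) {ι : Type*} [Fintype ι]
    {u : ι → ℝ} (hu : ∀ j, 0 ≤ u j) (hu1 : ∑ j, u j = 1) {z : ι → E} {φ : E → ℝ} {p q w : E}
    {γ L : ℝ} (hγ : 0 ≤ γ) (hq : q ∈ subdiffConvex φ (∑ j, u j • z j)) (hL : ‖q‖ ≤ L)
    (hw : w ∈ K) (h : IsProj K ((∑ j, u j • z j) - γ • q) p) :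
    ‖p - w‖ ^ 2 ≤ (∑ j, u j * ‖z j - w‖ ^ 2) + L ^ 2 * γ ^ 2
      + 2 * γ * (φ w - φ (∑ j, u j • z j)) := by
  have h1 := h.norm_sub_sq_le_of_step hK hγ hq hL hw
  have h2 := norm_sum_smul_sub_sq_le hu hu1 z w
  linarith

end Projection

/-! ### Saddle points of strictly convex-concave functions -/

section Saddle

variable {E F : Type*} {X : Set E} {Y : Set F}

variable [NormedAddCommGroup E] [NormedSpace ℝ E] [NormedAddCommGroup F] [NormedSpace ℝ F]

/-- The saddle inequalities close the cycle `φ a b' ≤ φ a b ≤ φ a' b ≤ φ a' b' ≤ φ a b'`, so all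
four values agree. Then `a` and `a'` both minimize `φ · b'`, and `b` and `b'` both maximize `φ a`.
-/
theorem IsSaddle.unique (hX : Convex ℝ X) (hY : Convex ℝ Y)
    {φ : E → F → ℝ} (hφ : StrictlyConvexConcave φ) {a a' : E} {b b' : F}
    (h : IsSaddle X Y φ a b) (h' : IsSaddle X Y φ a' b') : a = a' ∧ b = b' := by
  obtain ⟨ha, hb, h1, h2⟩ := h
  obtain ⟨ha', hb', h1', h2'⟩ := h'
  have e1 := h1 b' hb'
  have e2 := h2 a' ha'
  have e3 := h1' b hb
  have e4 := h2' a ha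
  constructor
  · exact ((hφ.1 b').subset (Set.subset_univ X) hX).eq_of_isMinOn
      (fun x hx => show φ a b' ≤ φ x b' by linarith [h2' x hx])
      (fun x hx => h2' x hx) ha ha'
  · exact ((hφ.2 a).subset (Set.subset_univ Y) hY).eq_of_isMaxOn
      (fun y hy => h1 y hy)
      (fun y hy => show φ a y ≤ φ a b' by linarith [h1 y hy]) hb hb'

/-- The gap is the sum of the nonnegative terms `φ x b - φ a b` and `φ a b - φ a y`; if both vanish,
strictness forces `x = a` and `y = b`. -/
theorem IsSaddle.pos_of_ne (hX : Convex ℝ X) (hY : Convex ℝ Y)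
    {φ : E → F → ℝ} (hφ : StrictlyConvexConcave φ) {a x : E} {b y : F}
    (h : IsSaddle X Y φ a b) (hx : x ∈ X) (hy : y ∈ Y) (hne : x ≠ a ∨ y ≠ b) :
    0 < φ x b - φ a y := by
  obtain ⟨ha, hb, h1, h2⟩ := h
  by_contra! hle
  have e1 := h1 y hy
  have e2 := h2 x hx
  rcases hne with hne | hne
  · exact hne <| ((hφ.1 b).subset (Set.subset_univ X) hX).eq_of_isMinOn
      (fun x' hx' => show φ x b ≤ φ x' b by linarith [h2 x' hx']) (fun x' hx' => h2 x' hx') hx ha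
  · exact hne <| ((hφ.2 a).subset (Set.subset_univ Y) hY).eq_of_isMaxOn
      (fun y' hy' => show φ a y' ≤ φ a y by linarith [h1 y' hy']) (fun y' hy' => h1 y' hy') hy hb

theorem StrictlyConvexConcave.sum {n : ℕ} (hn : 0 < n)
    {f : Fin n → E → F → ℝ} (hf : ∀ i, StrictlyConvexConcave (f i)) :
    StrictlyConvexConcave fun x y => ∑ i, f i x y := by
  have hne : (Finset.univ : Finset (Fin n)).Nonempty := ⟨⟨0, hn⟩, Finset.mem_univ _⟩
  constructor
  · refine fun y => ⟨convex_univ, fun x hx x' hx' hxx' s t hs ht hst => ?_⟩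
    simp only [smul_eq_mul, Finset.mul_sum, ← Finset.sum_add_distrib]
    exact Finset.sum_lt_sum_of_nonempty hne fun i _ => ((hf i).1 y).2 hx hx' hxx' hs ht hst
  · refine fun x => ⟨convex_univ, fun y hy y' hy' hyy' s t hs ht hst => ?_⟩
    simp only [smul_eq_mul, Finset.mul_sum, ← Finset.sum_add_distrib]
    exact Finset.sum_lt_sum_of_nonempty hne fun i _ => ((hf i).2 x).2 hy hy' hyy' hs ht hst

end Saddle

/-! ### Sequences that decrease up to summable errors -/

section Series

theorem tendsto_zero_of_sq {u : ℕ → ℝ} (h : Tendsto (fun k => u k ^ 2) atTop (𝓝 0)) :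
    Tendsto u atTop (𝓝 0) := by
  have h' := h.sqrt
  simp only [Real.sqrt_sq_eq_abs, Real.sqrt_zero] at h'
  exact (tendsto_zero_iff_abs_tendsto_zero u).2 h'

/-- Telescoping would make `M` negative: the errors have a finite sum while `c * ∑ γ k` diverges. -/
theorem not_eventually_le_add_sub_mul {M ε γ : ℕ → ℝ} {c : ℝ} (hM : ∀ k, 0 ≤ M k)
    (hε : Summable ε) (hε0 : ∀ k, 0 ≤ ε k)
    (hγ : Tendsto (fun N => ∑ k ∈ Finset.range N, γ k) atTop atTop) (hc : 0 < c) :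
    ¬ ∀ᶠ k in atTop, M (k + 1) ≤ M k + ε k - c * γ k := by
  intro h
  obtain ⟨N, hN⟩ := eventually_atTop.1 h
  have key : ∀ t, M (N + t) + c * ∑ k ∈ Finset.range (N + t), γ k
      ≤ M N + c * ∑ k ∈ Finset.range N, γ k
        + (∑ k ∈ Finset.range (N + t), ε k - ∑ k ∈ Finset.range N, ε k) := by
    intro t
    induction t with
    | zero => simp
    | succ t ih =>
      rw [← add_assoc, Finset.sum_range_succ, Finset.sum_range_succ _ (N + t)]
      have := hN (N + t) (Nat.le_add_right _ _)
      linarith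
  have hlim : Tendsto (fun t => c * ∑ k ∈ Finset.range (N + t), γ k) atTop atTop :=
    (hγ.comp (tendsto_atTop_mono (fun t => Nat.le_add_left t N) tendsto_id)).const_mul_atTop hc
  obtain ⟨t, ht⟩ := (hlim.eventually_gt_atTop
    (M N + c * ∑ k ∈ Finset.range N, γ k + ∑' k, ε k)).exists
  have h1 := key t
  have h2 := hM (N + t)
  have h3 := hε.sum_le_tsum (Finset.range (N + t)) fun i _ => hε0 i
  have h4 := Finset.sum_nonneg fun k (_ : k ∈ Finset.range N) => hε0 k
  linarith

theorem exists_tendsto_of_le_add {M ε : ℕ → ℝ} (hM : ∀ k, 0 ≤ M k) (hε : Summable ε)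
    (hε0 : ∀ k, 0 ≤ ε k) (h : ∀ k, M (k + 1) ≤ M k + ε k) : ∃ ξ, Tendsto M atTop (𝓝 ξ) := by
  have hanti : Antitone fun k => M k - ∑ j ∈ Finset.range k, ε j := by
    refine antitone_nat_of_succ_le fun k => ?_
    rw [Finset.sum_range_succ]
    linarith [h k]
  have hbdd : BddBelow (Set.range fun k => M k - ∑ j ∈ Finset.range k, ε j) := by
    refine ⟨-∑' j, ε j, ?_⟩
    rintro _ ⟨k, rfl⟩
    have := hε.sum_le_tsum (Finset.range k) fun i _ => hε0 i
    have := hM k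
    dsimp only
    linarith
  refine ⟨_, ((tendsto_atTop_ciInf hanti hbdd).add hε.hasSum.tendsto_sum_nat).congr fun k => ?_⟩
  ring

end Series

/-! ### Descent estimates along trajectories and sufficiency -/

section Trajectory

variable {E F : Type*} [NormedAddCommGroup E] [InnerProductSpace ℝ E]
  [NormedAddCommGroup F] [InnerProductSpace ℝ F] {n : ℕ} {X : Set E} {Y : Set F}
  {f : Fin n → E → F → ℝ} {G : ℕ → WeightedDigraph n} {γ : ℕ → ℝ}
  {x : ℕ → Fin n → E} {y : ℕ → Fin n → F} {L : ℝ}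

/-- `L` bounds the subgradients of all `f i` at all points of `X × Y`. -/
def SubgradientBound (X : Set E) (Y : Set F) (f : Fin n → E → F → ℝ) (L : ℝ) : Prop :=
  ∀ i, ∀ x ∈ X, ∀ y ∈ Y,
    (∀ q ∈ subdiffConvex (fun x' => f i x' y) x, ‖q‖ ≤ L) ∧
      ∀ q ∈ subdiffConcave (fun y' => f i x y') y, ‖q‖ ≤ L

/-- Exchanging the players and negating the objectives preserves the setting, so each estimate for
`x` also yields one for `y`. -/
theorem SubgradientBound.neg_swap (h : SubgradientBound X Y f L) :
    SubgradientBound Y X (fun i y x => -f i x y) L := by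
  refine fun i y hy x hx => ⟨fun q hq => ?_, fun q hq => ?_⟩
  · rw [← norm_neg]
    refine (h i x hx y hy).2 _ (mem_subdiffConcave_iff_neg_mem.2 ?_)
    rwa [neg_neg]
  · rw [← norm_neg]
    refine (h i x hx y hy).1 _ ?_
    simpa using mem_subdiffConcave_iff_neg_mem.1 hq

theorem IsTrajectory.neg_swap (h : IsTrajectory X Y f G γ x y) :
    IsTrajectory Y X (fun i y x => -f i x y) G γ y x := by
  intro k i
  obtain ⟨⟨q, hq, hp⟩, r, hr, hs⟩ := h k i
  refine ⟨⟨-r, mem_subdiffConcave_iff_neg_mem.1 hr, ?_⟩, -q,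
    mem_subdiffConcave_iff_neg_mem.2 ?_, ?_⟩
  · rwa [smul_neg, sub_neg_eq_add]
  · simpa using hq
  · rwa [smul_neg, ← sub_eq_add_neg]

theorem StrictlyConvexConcave.neg_swap {φ : E → F → ℝ} (h : StrictlyConvexConcave φ) :
    StrictlyConvexConcave fun y x => -φ x y :=
  ⟨fun x => (h.2 x).neg, fun y => (h.1 y).neg⟩

theorem IsTrajectory.norm_sub_average_le (hX : Convex ℝ X) (hL : SubgradientBound X Y f L)
    (hG : WeightRule G) (h : IsTrajectory X Y f G γ x y) {k : ℕ} (hγ : 0 ≤ γ k)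
    (hx : ∀ i, x k i ∈ X) (hy : ∀ i, y k i ∈ Y) (i : Fin n) :
    ‖x (k + 1) i - ∑ j, (G k).weight i j • x k j‖ ≤ L * γ k := by
  obtain ⟨⟨q, hq, hp⟩, -⟩ := h k i
  have hz : ∑ j, (G k).weight i j • x k j ∈ X :=
    hX.sum_mem (fun j _ => (G k).weight_nonneg i j) (hG.2 k i) fun j _ => hx j
  exact hp.norm_sub_le_of_step hX hγ ((hL i _ hz _ (hy i)).1 q hq) hz

theorem IsTrajectory.norm_sub_sq_le (hX : Convex ℝ X) (hL : SubgradientBound X Y f L)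
    (hG : WeightRule G) (h : IsTrajectory X Y f G γ x y) {k : ℕ} (hγ : 0 ≤ γ k)
    (hx : ∀ i, x k i ∈ X) (hy : ∀ i, y k i ∈ Y) {w : E} (hw : w ∈ X) (i : Fin n) :
    ‖x (k + 1) i - w‖ ^ 2 ≤ (∑ j, (G k).weight i j * ‖x k j - w‖ ^ 2) + L ^ 2 * γ k ^ 2
      + 2 * γ k * (f i w (y k i) - f i (∑ j, (G k).weight i j • x k j) (y k i)) := by
  obtain ⟨⟨q, hq, hp⟩, -⟩ := h k i
  have hz : ∑ j, (G k).weight i j • x k j ∈ X :=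
    hX.sum_mem (fun j _ => (G k).weight_nonneg i j) (hG.2 k i) fun j _ => hx j
  exact hp.norm_sub_sq_le_of_average_step hX (fun j => (G k).weight_nonneg i j) (hG.2 k i) hγ hq
    ((hL i _ hz _ (hy i)).1 q hq) hw

theorem SubgradientBound.sub_le [FiniteDimensional ℝ E] (hL : SubgradientBound X Y f L)
    (hf : ∀ i, StrictlyConvexConcave (f i)) {u w : E} {v : F} (hu : u ∈ X)
    (hv : v ∈ Y) (i : Fin n) : f i u v - f i w v ≤ L * ‖u - w‖ := by
  obtain ⟨q, hq⟩ := ((hf i).1 v).convexOn.subdiffConvex_nonempty u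
  exact sub_le_of_mem_subdiffConvex hq ((hL i u hu v hv).1 q hq)

/-- One step of the algorithm moves the states towards a point `(a, b)` of `X × Y`, up to errors
controlled by the stepsize and the disagreements and to the gap of the objective functions. -/
theorem IsTrajectory.norm_sub_sq_add_le [FiniteDimensional ℝ E] [FiniteDimensional ℝ F]
    (hX : Convex ℝ X) (hY : Convex ℝ Y) (hf : ∀ i, StrictlyConvexConcave (f i)) (hL0 : 0 ≤ L)
    (hL : SubgradientBound X Y f L) (hG : WeightRule G) (h : IsTrajectory X Y f G γ x y) {k : ℕ}
    (hγ : 0 ≤ γ k) (hx : ∀ i, x k i ∈ X) (hy : ∀ i, y k i ∈ Y) {a : E} {b : F} (ha : a ∈ X)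
    (hb : b ∈ Y) (i : Fin n) :
    ‖x (k + 1) i - a‖ ^ 2 + ‖y (k + 1) i - b‖ ^ 2
      ≤ (∑ j, (G k).weight i j * (‖x k j - a‖ ^ 2 + ‖y k j - b‖ ^ 2))
        + (2 * (L ^ 2 + L) * γ k ^ 2 + L * disagreement (x k) ^ 2 + L * disagreement (y k) ^ 2)
        - 2 * γ k * (f i (x k i) b - f i a (y k i)) := by
  have h1 := h.norm_sub_sq_le hX hL hG hγ hx hy ha i
  have h2 := h.neg_swap.norm_sub_sq_le hY hL.neg_swap hG hγ hy hx hb i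
  set x' := ∑ j, (G k).weight i j • x k j
  set y' := ∑ j, (G k).weight i j • y k j
  -- The value `f i (x k i) (y k i)` is inserted into both steps and cancels in the sum; this
  -- replaces the averages by the agents' own states at the cost of the disagreements.
  have h3 : f i (x k i) (y k i) - f i x' (y k i) ≤ L * disagreement (x k) := by
    refine (hL.sub_le hf (hx i) (hy i) i).trans (mul_le_mul_of_nonneg_left ?_ hL0)
    rw [norm_sub_rev]
    exact norm_sum_smul_sub_le_disagreement ((G k).weight_nonneg i) (hG.2 k i) _ i
  have h4 : -f i (x k i) (y k i) - -f i (x k i) y' ≤ L * disagreement (y k) := by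
    refine (hL.neg_swap.sub_le (fun i => (hf i).neg_swap) (hy i) (hx i) i).trans
      (mul_le_mul_of_nonneg_left ?_ hL0)
    rw [norm_sub_rev]
    exact norm_sum_smul_sub_le_disagreement ((G k).weight_nonneg i) (hG.2 k i) _ i
  have h5 := mul_le_mul_of_nonneg_left (add_le_add h3 h4) (mul_nonneg zero_le_two hγ)
  -- Used as `2 * γ * d ≤ γ ^ 2 + d ^ 2`, which turns the mixed errors into summable ones.
  have h6 := mul_nonneg hL0 (sq_nonneg (γ k - disagreement (x k)))
  have h7 := mul_nonneg hL0 (sq_nonneg (γ k - disagreement (y k)))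
  simp only [mul_add, Finset.sum_add_distrib]
  linarith

theorem StrictlyConvexConcave.continuous_left [FiniteDimensional ℝ E] {φ : E → F → ℝ}
    (h : StrictlyConvexConcave φ) (v : F) : Continuous fun u => φ u v :=
  (h.1 v).convexOn.locallyLipschitz.continuous

theorem StrictlyConvexConcave.continuous_right [FiniteDimensional ℝ F] {φ : E → F → ℝ}
    (h : StrictlyConvexConcave φ) (u : E) : Continuous (φ u) :=
  (h.2 u).concaveOn.locallyLipschitz.continuous

/-- Away from `(a, b)` each gap is positive, and being continuous it attains a positive minimum on
the compact set in question; finitely many indices leave a common bound. -/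
theorem IsSaddle.exists_gap [FiniteDimensional ℝ E] [FiniteDimensional ℝ F]
    (hXc : IsClosed X) (hX : Convex ℝ X) (hYc : IsClosed Y) (hY : Convex ℝ Y)
    (hf : ∀ i, StrictlyConvexConcave (f i)) {a : E} {b : F} (h : ∀ i, IsSaddle X Y (f i) a b)
    {r R : ℝ} (hr : 0 < r) :
    ∃ c > 0, ∀ u ∈ X, ∀ v ∈ Y, r ≤ ‖u - a‖ ^ 2 + ‖v - b‖ ^ 2 → ‖u - a‖ ≤ R → ‖v - b‖ ≤ R →
      ∀ i, c ≤ f i u b - f i a v := by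
  have : ProperSpace E := FiniteDimensional.proper ℝ E
  have : ProperSpace F := FiniteDimensional.proper ℝ F
  let K : Set (E × F) := {p | r ≤ ‖p.1 - a‖ ^ 2 + ‖p.2 - b‖ ^ 2} ∩
    ((X ∩ Metric.closedBall a R) ×ˢ (Y ∩ Metric.closedBall b R))
  have hK : IsCompact K := by
    refine IsCompact.inter_left ?_ (isClosed_le continuous_const (by fun_prop))
    exact ((isCompact_closedBall a R).inter_left hXc).prod ((isCompact_closedBall b R).inter_left hYc)
  have hex : ∀ i, ∃ c > 0, ∀ p ∈ K, c ≤ f i p.1 b - f i a p.2 := by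
    intro i
    rcases K.eq_empty_or_nonempty with hK0 | hKne
    · exact ⟨1, one_pos, by simp [hK0]⟩
    · have hcont : Continuous fun p : E × F => f i p.1 b - f i a p.2 :=
        (((hf i).continuous_left b).comp continuous_fst).sub
          (((hf i).continuous_right a).comp continuous_snd)
      obtain ⟨p, hp, hmin⟩ := hK.exists_isMinOn hKne hcont.continuousOn
      refine ⟨_, (h i).pos_of_ne hX hY (hf i) hp.2.1.1 hp.2.2.1 ?_, hmin⟩
      by_contra! hpe
      have := hp.1
      simp only [Set.mem_ofPred_eq, hpe.1, hpe.2, sub_self, norm_zero] at this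
      norm_num at this
      linarith
  choose c hc hcK using hex
  rcases isEmpty_or_nonempty (Fin n) with hn | hn
  · exact ⟨1, one_pos, fun u _ v _ _ _ _ i => isEmptyElim i⟩
  · obtain ⟨i₀, hi₀⟩ := Finite.exists_min c
    refine ⟨c i₀, hc i₀, fun u hu v hv h1 h2 h3 i => (hi₀ i).trans (hcK i (u, v) ?_)⟩
    exact ⟨h1, ⟨hu, mem_closedBall_iff_norm.2 h2⟩, hv, mem_closedBall_iff_norm.2 h3⟩

theorem IsTrajectory.tendsto_of_forall_isSaddle_of_mem [FiniteDimensional ℝ E]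
    [FiniteDimensional ℝ F] (hXc : IsClosed X) (hX : Convex ℝ X) (hYc : IsClosed Y)
    (hY : Convex ℝ Y) (hf : ∀ i, StrictlyConvexConcave (f i)) (hL0 : 0 ≤ L)
    (hL : SubgradientBound X Y f L) (hU : UJSC G) (hG : WeightRule G) (hγ : StepsizeRule γ)
    (h : IsTrajectory X Y f G γ x y) (hx : ∀ k i, x k i ∈ X) (hy : ∀ k i, y k i ∈ Y) {a : E} {b : F}
    (hab : ∀ i, IsSaddle X Y (f i) a b) (i : Fin n) :
    Tendsto (fun k => x k i) atTop (𝓝 a) ∧ Tendsto (fun k => y k i) atTop (𝓝 b) := by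
  obtain ⟨hγ0, hγa, hγ1, hγ2⟩ := hγ
  have hanti : Antitone fun k => L * γ k := fun k l hkl => mul_le_mul_of_nonneg_left (hγa hkl) hL0
  have hpos : ∀ k, 0 ≤ L * γ k := fun k => mul_nonneg hL0 (hγ0 k).le
  have hsq : Summable fun k => (L * γ k) ^ 2 := by
    simpa only [mul_pow] using hγ2.mul_left (L ^ 2)
  have hDx : Summable fun k => disagreement (x k) ^ 2 :=
    summable_disagreement_sq hU hG hanti hpos hsq fun k =>
      h.norm_sub_average_le hX hL hG (hγ0 k).le (hx k) (hy k)
  have hDy : Summable fun k => disagreement (y k) ^ 2 :=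
    summable_disagreement_sq hU hG hanti hpos hsq fun k =>
      h.neg_swap.norm_sub_average_le hY hL.neg_swap hG (hγ0 k).le (hy k) (hx k)
  set ε : ℕ → ℝ := fun k => 2 * (L ^ 2 + L) * γ k ^ 2 + L * disagreement (x k) ^ 2
    + L * disagreement (y k) ^ 2 with hεdef
  have hε : Summable ε := ((hγ2.mul_left _).add (hDx.mul_left _)).add (hDy.mul_left _)
  have hε0 : ∀ k, 0 ≤ ε k := fun k => by positivity
  set V : ℕ → Fin n → ℝ := fun k i => ‖x k i - a‖ ^ 2 + ‖y k i - b‖ ^ 2 with hVdef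
  have hV0 : ∀ k i, 0 ≤ V k i := fun k i => by positivity
  have hVM : ∀ k i, V k i ≤ ‖V k‖ := fun k i =>
    (Real.le_norm_self _).trans (norm_le_pi_norm (V k) i)
  have hMV : ∀ k r, 0 ≤ r → (∀ i, V k i ≤ r) → ‖V k‖ ≤ r := fun k r hr hle =>
    (pi_norm_le_iff_of_nonneg hr).2 fun i => by
      rw [Real.norm_of_nonneg (hV0 k i)]
      exact hle i
  have hstep : ∀ k i, V (k + 1) i ≤ ‖V k‖ + ε k - 2 * γ k * (f i (x k i) b - f i a (y k i)) := by
    intro k i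
    have h1 := h.norm_sub_sq_add_le hX hY hf hL0 hL hG (hγ0 k).le (hx k) (hy k) (hab i).1
      (hab i).2.1 i
    have h2 : ∑ j, (G k).weight i j * V k j ≤ ‖V k‖ := by
      calc _ ≤ ∑ j, (G k).weight i j * ‖V k‖ := Finset.sum_le_sum fun j _ =>
            mul_le_mul_of_nonneg_left (hVM k j) ((G k).weight_nonneg i j)
        _ = ‖V k‖ := by rw [← Finset.sum_mul, hG.2, one_mul]
    simp only [hVdef, hεdef] at h2 ⊢
    linarith
  have hgap : ∀ k i, 0 ≤ f i (x k i) b - f i a (y k i) := fun k i => by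
    have h1 := (hab i).2.2.1 _ (hy k i)
    have h2 := (hab i).2.2.2 _ (hx k i)
    linarith
  have hM : ∀ k, ‖V (k + 1)‖ ≤ ‖V k‖ + ε k := fun k =>
    hMV _ _ (add_nonneg (norm_nonneg _) (hε0 k)) fun i => by
      have := mul_nonneg (mul_nonneg zero_le_two (hγ0 k).le) (hgap k i)
      linarith [hstep k i]
  obtain ⟨ξ, hξ⟩ := exists_tendsto_of_le_add (fun k => norm_nonneg (V k)) hε hε0 hM
  have hξ0 : 0 ≤ ξ := ge_of_tendsto' hξ fun k => norm_nonneg _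
  have hzero : ξ = 0 := by
    by_contra hne
    have hξpos : 0 < ξ := lt_of_le_of_ne hξ0 (Ne.symm hne)
    obtain ⟨R, hR⟩ := hξ.bddAbove_range
    have hVR : ∀ k i, V k i ≤ R := fun k i => (hVM k i).trans (hR ⟨k, rfl⟩)
    have hR0 : 0 ≤ R := (hV0 0 i).trans (hVR 0 i)
    -- `R` bounds squared distances; `2 * t ≤ t ^ 2 + 1` makes `R + 1` a bound for the distances.
    have hxR : ∀ k i, ‖x k i - a‖ ≤ R + 1 := fun k i => by
      have := hVR k i
      nlinarith [sq_nonneg ‖y k i - b‖, sq_nonneg (‖x k i - a‖ - 1)]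
    have hyR : ∀ k i, ‖y k i - b‖ ≤ R + 1 := fun k i => by
      have := hVR k i
      nlinarith [sq_nonneg ‖x k i - a‖, sq_nonneg (‖y k i - b‖ - 1)]
    have hdis : Tendsto (fun k => 2 * (R + 1) * disagreement (x k)
        + 2 * (R + 1) * disagreement (y k)) atTop (𝓝 0) := by
      simpa using ((tendsto_zero_of_sq hDx.tendsto_atTop_zero).const_mul (2 * (R + 1))).add
        ((tendsto_zero_of_sq hDy.tendsto_atTop_zero).const_mul (2 * (R + 1)))
    obtain ⟨c, hc, hcgap⟩ := IsSaddle.exists_gap hXc hX hYc hY hf hab (r := ξ / 4) (R := R + 1)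
      (by linarith)
    refine not_eventually_le_add_sub_mul (c := 2 * c) (fun k => norm_nonneg (V k)) hε hε0 hγ1
      (by linarith) ?_
    filter_upwards [hξ.eventually_const_lt (show ξ / 2 < ξ by linarith),
      hdis.eventually_lt_const (show 0 < ξ / 4 by linarith)] with k hk1 hk2
    -- The largest entry exceeds `ξ / 2`, and small disagreement keeps every entry within `ξ / 4` of
    -- it. Hence every agent has a gap at least `c`, as a decrease of the maximum requires.
    have hVlow : ∀ i, ξ / 4 ≤ V k i := by
      intro i
      have : ‖V k‖ ≤ V k i + ξ / 4 := hMV _ _ (by linarith [hV0 k i]) fun j => by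
        have h1 := norm_sub_sq_sub_norm_sub_sq_le (x k) a (hxR k) i j
        have h2 := norm_sub_sq_sub_norm_sub_sq_le (y k) b (hyR k) i j
        simp only [hVdef]
        linarith
      linarith
    have hlow : ∀ j, V (k + 1) j ≤ ‖V k‖ + ε k - 2 * c * γ k := fun j => by
      have h1 := hcgap _ (hx k j) _ (hy k j) (hVlow j) (hxR k j) (hyR k j) j
      have h2 := mul_le_mul_of_nonneg_left h1 (hγ0 k).le
      linarith [hstep k j]
    exact hMV _ _ ((hV0 _ i).trans (hlow i)) hlow
  rw [hzero] at hξ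
  have hbound : ∀ u : ℕ → ℝ, (∀ k, u k ^ 2 ≤ ‖V k‖) → Tendsto u atTop (𝓝 0) := fun u hu =>
    tendsto_zero_of_sq (squeeze_zero (fun k => sq_nonneg _) hu hξ)
  constructor
  · refine tendsto_iff_norm_sub_tendsto_zero.2 (hbound _ fun k => ?_)
    exact le_trans (le_add_of_nonneg_right (sq_nonneg _)) (hVM k i)
  · refine tendsto_iff_norm_sub_tendsto_zero.2 (hbound _ fun k => ?_)
    exact le_trans (le_add_of_nonneg_left (sq_nonneg _)) (hVM k i)

theorem UJSC.shift (h : UJSC G) : UJSC fun k => G (k + 1) := by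
  obtain ⟨T, hT, h⟩ := h
  refine ⟨T, hT, fun k i j => Relation.ReflTransGen.mono ?_ i j (h (k + 1) i j)⟩
  rintro u v ⟨s, h1, h2, harc⟩
  refine ⟨s - 1, by omega, by omega, ?_⟩
  dsimp only
  rwa [Nat.sub_add_cancel (by omega)]

theorem WeightRule.shift (h : WeightRule G) : WeightRule fun k => G (k + 1) := by
  obtain ⟨⟨η, h0, h1, h2⟩, h3⟩ := h
  exact ⟨⟨η, h0, h1, fun k => h2 (k + 1)⟩, fun k => h3 (k + 1)⟩

theorem StepsizeRule.shift (h : StepsizeRule γ) : StepsizeRule fun k => γ (k + 1) := by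
  obtain ⟨h0, h1, h2, h3⟩ := h
  refine ⟨fun k => h0 _, fun k l hkl => h1 (Nat.succ_le_succ hkl), ?_,
    (summable_nat_add_iff 1).2 h3⟩
  refine (tendsto_atTop_add_const_right _ (-γ 0) (h2.comp (tendsto_add_atTop_nat 1))).congr
    fun N => ?_
  simp [Finset.sum_range_succ']

theorem achievesNash_of_forall_isSaddle [FiniteDimensional ℝ E]
    [FiniteDimensional ℝ F] (hXc : IsClosed X) (hX : Convex ℝ X) (hYc : IsClosed Y)
    (hY : Convex ℝ Y) (hn : 0 < n) (hf : ∀ i, StrictlyConvexConcave (f i))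
    (hbounded : BoundedSubgradients X Y f) (hU : UJSC G) (hG : WeightRule G)
    (hγ : StepsizeRule γ) {a : E} {b : F} (hab : ∀ i, IsSaddle X Y (f i) a b) :
    AchievesNash X Y f G γ := by
  intro x y h
  obtain ⟨L, hL0, hL⟩ := hbounded
  -- The initial states may lie outside `X × Y`; after one projection all states lie inside, so the
  -- argument starts at time one.
  have key := fun i => IsTrajectory.tendsto_of_forall_isSaddle_of_mem hXc hX hYc hY hf hL0.le hL
    hU.shift hG.shift hγ.shift (x := fun k => x (k + 1)) (y := fun k => y (k + 1))
    (fun k => h (k + 1)) (fun k i => (h k i).1.choose_spec.2.1)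
    (fun k i => (h k i).2.choose_spec.2.1) hab i
  refine ⟨a, b, ⟨(hab ⟨0, hn⟩).1, (hab ⟨0, hn⟩).2.1, fun v hv => ?_, fun u hu => ?_⟩,
    fun i => (tendsto_add_atTop_iff_nat 1).1 (key i).1,
    fun i => (tendsto_add_atTop_iff_nat 1).1 (key i).2⟩
  · exact Finset.sum_le_sum fun i _ => (hab i).2.2.1 v hv
  · exact Finset.sum_le_sum fun i _ => (hab i).2.2.2 u hu

end Trajectory

/-! ### Necessity, through constant complete digraphs -/

section Necessity

variable {E F : Type*} [NormedAddCommGroup E] [InnerProductSpace ℝ E] [FiniteDimensional ℝ E]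
  [NormedAddCommGroup F] [InnerProductSpace ℝ F] [FiniteDimensional ℝ F] {n : ℕ}
  {X : Set E} {Y : Set F} {f : Fin n → E → F → ℝ} {γ : ℕ → ℝ}

theorem exists_isProj {K : Set E} (hne : K.Nonempty) (hcl : IsClosed K) (hcv : Convex ℝ K)
    (z : E) : ∃ p, IsProj K z p := by
  have : CompleteSpace E := FiniteDimensional.complete ℝ E
  exact exists_norm_eq_iInf_of_complete_convex hne hcl.isComplete hcv z

/-- `AchievesNash` quantifies over trajectories, so extracting a limit from it needs one to exist.
Starting at `(a, b)` keeps it in `X × Y` from time zero. -/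
theorem exists_isTrajectory (hXc : IsClosed X) (hX : Convex ℝ X) (hYc : IsClosed Y)
    (hY : Convex ℝ Y) (hf : ∀ i, StrictlyConvexConcave (f i)) {a : E} {b : F} (ha : a ∈ X)
    (hb : b ∈ Y) (G : ℕ → WeightedDigraph n) (γ : ℕ → ℝ) :
    ∃ x y, IsTrajectory X Y f G γ x y ∧ (∀ k i, x k i ∈ X) ∧ ∀ k i, y k i ∈ Y := by
  have hstepx : ∀ (k : ℕ) (s : (Fin n → E) × (Fin n → F)) (i : Fin n), ∃ p,
      ∃ q ∈ subdiffConvex (fun x' => f i x' (s.2 i)) (∑ j, (G k).weight i j • s.1 j),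
        IsProj X ((∑ j, (G k).weight i j • s.1 j) - γ k • q) p := by
    intro k s i
    obtain ⟨q, hq⟩ := ((hf i).1 (s.2 i)).convexOn.subdiffConvex_nonempty
      (∑ j, (G k).weight i j • s.1 j)
    obtain ⟨p, hp⟩ := exists_isProj ⟨a, ha⟩ hXc hX ((∑ j, (G k).weight i j • s.1 j) - γ k • q)
    exact ⟨p, q, hq, hp⟩
  have hstepy : ∀ (k : ℕ) (s : (Fin n → E) × (Fin n → F)) (i : Fin n), ∃ p,
      ∃ q ∈ subdiffConcave (fun y' => f i (s.1 i) y') (∑ j, (G k).weight i j • s.2 j),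
        IsProj Y ((∑ j, (G k).weight i j • s.2 j) + γ k • q) p := by
    intro k s i
    obtain ⟨q, hq⟩ := ((hf i).2 (s.1 i)).concaveOn.subdiffConcave_nonempty
      (∑ j, (G k).weight i j • s.2 j)
    obtain ⟨p, hp⟩ := exists_isProj ⟨b, hb⟩ hYc hY ((∑ j, (G k).weight i j • s.2 j) + γ k • q)
    exact ⟨p, q, hq, hp⟩
  choose px hpx using hstepx
  choose py hpy using hstepy
  let s : ℕ → (Fin n → E) × (Fin n → F) := fun k =>
    Nat.rec (fun _ => a, fun _ => b) (fun k s => (px k s, py k s)) k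
  refine ⟨fun k => (s k).1, fun k => (s k).2, fun k i => ⟨hpx k (s k) i, hpy k (s k) i⟩,
    fun k i => ?_, fun k i => ?_⟩
  · cases k with
    | zero => exact ha
    | succ k => exact (hpx k (s k) i).choose_spec.2.1
  · cases k with
    | zero => exact hb
    | succ k => exact (hpy k (s k) i).choose_spec.2.1

/-- The complete digraph in which every node `i` takes the state of every node `j` with the
weight `μ j`. -/
def WeightedDigraph.ofVector (μ : Fin n → ℝ) (hμ : ∀ i, 0 < μ i) : WeightedDigraph n where
  weight := Matrix.of fun _ j => μ j
  weight_nonneg _ _ := (hμ _).le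
  self_loop i := hμ i

theorem uJSC_ofVector (μ : Fin n → ℝ) (hμ : ∀ i, 0 < μ i) :
    UJSC fun _ => WeightedDigraph.ofVector μ hμ :=
  ⟨1, one_pos, fun k i _ => Relation.ReflTransGen.single ⟨k, le_rfl, Nat.lt_succ_self k, hμ i⟩⟩

theorem weightRule_ofVector (hn : 0 < n) (μ : Fin n → ℝ) (hμ : ∀ i, 0 < μ i)
    (hμ1 : ∑ i, μ i = 1) : WeightRule fun _ => WeightedDigraph.ofVector μ hμ := by
  have : Nonempty (Fin n) := ⟨⟨0, hn⟩⟩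
  obtain ⟨i₀, hi₀⟩ := Finite.exists_min μ
  have h1 : μ i₀ ≤ 1 :=
    hμ1 ▸ Finset.single_le_sum (fun i _ => (hμ i).le) (Finset.mem_univ i₀)
  -- Halving secures the strict bound `η < 1` even when `n = 1`, where the only weight is one.
  refine ⟨⟨μ i₀ / 2, half_pos (hμ i₀), by linarith, fun _ _ j _ => ?_⟩, fun _ _ => hμ1⟩
  exact (half_le_self (hμ i₀).le).trans (hi₀ j)

/-- If the states of a trajectory along the constant digraph with the Perron vector `μ` converge to
a consensus `(a, b)`, then `a` minimizes `∑ i, μ i * f i · b`. -/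
theorem IsTrajectory.sum_mul_le_of_tendsto {L : ℝ} (hX : Convex ℝ X)
    (hf : ∀ i, StrictlyConvexConcave (f i)) (hL : SubgradientBound X Y f L)
    (hγ : StepsizeRule γ) {μ : Fin n → ℝ} (hμ : ∀ i, 0 < μ i) (hμ1 : ∑ i, μ i = 1)
    (hG : WeightRule fun _ => WeightedDigraph.ofVector μ hμ) {x : ℕ → Fin n → E}
    {y : ℕ → Fin n → F} (h : IsTrajectory X Y f (fun _ => WeightedDigraph.ofVector μ hμ) γ x y)
    (hx : ∀ k i, x k i ∈ X) (hy : ∀ k i, y k i ∈ Y) {a : E} {b : F}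
    (hxa : ∀ i, Tendsto (fun k => x k i) atTop (𝓝 a))
    (hyb : ∀ i, Tendsto (fun k => y k i) atTop (𝓝 b)) (ha : a ∈ X) {w : E} (hw : w ∈ X) :
    ∑ i, μ i * f i a b ≤ ∑ i, μ i * f i w b := by
  obtain ⟨hγ0, -, hγ1, hγ2⟩ := hγ
  set z : ℕ → E := fun k => ∑ j, μ j • x k j with hz
  have hzX : ∀ k, z k ∈ X := fun k => hX.sum_mem (fun j _ => (hμ j).le) hμ1 fun j _ => hx k j
  have hza : Tendsto z atTop (𝓝 a) := by
    have := tendsto_finsetSum Finset.univ fun j _ => (hxa j).const_smul (μ j)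
    rwa [← Finset.sum_smul, hμ1, one_smul] at this
  have hfz : ∀ i, Tendsto (fun k => f i (z k) (y k i)) atTop (𝓝 (f i a b)) := by
    intro i
    have h1 : Tendsto (fun k => f i a (y k i)) atTop (𝓝 (f i a b)) :=
      (((hf i).continuous_right a).tendsto b).comp (hyb i)
    -- Both arguments move; the Lipschitz constant `L` in the first one is uniform in the second, so
    -- it suffices to let `y` vary at the fixed point `a`.
    have h2 : Tendsto (fun k => f i (z k) (y k i) - f i a (y k i)) atTop (𝓝 0) := by
      have h3 : Tendsto (fun k => L * ‖z k - a‖) atTop (𝓝 0) := by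
        simpa using (tendsto_iff_norm_sub_tendsto_zero.1 hza).const_mul L
      refine squeeze_zero_norm (fun k => ?_) h3
      refine abs_le.2 ⟨?_, hL.sub_le hf (hzX k) (hy k i) i⟩
      have := hL.sub_le hf (w := z k) ha (hy k i) i
      rw [norm_sub_rev] at this
      linarith
    simpa using h2.add h1
  have hfw : ∀ i, Tendsto (fun k => f i w (y k i)) atTop (𝓝 (f i w b)) := fun i =>
    (((hf i).continuous_right w).tendsto b).comp (hyb i)
  have hlim : Tendsto (fun k => ∑ i, μ i * (f i w (y k i) - f i (z k) (y k i))) atTop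
      (𝓝 (∑ i, μ i * (f i w b - f i a b))) :=
    tendsto_finsetSum _ fun i _ => ((hfw i).sub (hfz i)).const_mul (μ i)
  have hstep : ∀ k, ∑ i, μ i * ‖x (k + 1) i - w‖ ^ 2 ≤ ∑ i, μ i * ‖x k i - w‖ ^ 2
      + L ^ 2 * γ k ^ 2 + 2 * γ k * ∑ i, μ i * (f i w (y k i) - f i (z k) (y k i)) := by
    intro k
    have h1 := Finset.sum_le_sum fun i (_ : i ∈ Finset.univ) => mul_le_mul_of_nonneg_left
      (h.norm_sub_sq_le hX hL hG (hγ0 k).le (hx k) (hy k) hw i) (hμ i).le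
    refine h1.trans (le_of_eq ?_)
    simp only [mul_add, Finset.sum_add_distrib, ← Finset.sum_mul, hμ1, one_mul, Finset.mul_sum]
    congr 1
    · congr 1
      simp only [← Finset.mul_sum]
      change ∑ i, μ i * ∑ j, μ j * ‖x k j - w‖ ^ 2 = _
      rw [← Finset.sum_mul, hμ1, one_mul]
    · exact Finset.sum_congr rfl fun i _ => mul_left_comm _ _ _
  by_contra! hlt
  have hneg : ∑ i, μ i * (f i w b - f i a b) < 0 := by
    simp only [mul_sub, Finset.sum_sub_distrib]
    linarith
  set c := ∑ i, μ i * (f i w b - f i a b)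
  -- If `w` did better than `a`, the weighted gap would eventually be below `c / 2 < 0`, and the
  -- factor `2 * γ k` would give a decrease of at least `-c * γ k` up to summable errors.
  refine not_eventually_le_add_sub_mul (M := fun k => ∑ i, μ i * ‖x k i - w‖ ^ 2) (c := -c)
    (fun k => Finset.sum_nonneg fun i _ => mul_nonneg (hμ i).le (sq_nonneg _))
    (hγ2.mul_left (L ^ 2)) (fun k => by positivity) hγ1 (by linarith) ?_
  filter_upwards [hlim.eventually_lt_const (show c < c / 2 by linarith)] with k hk
  have := mul_le_mul_of_nonneg_left hk.le (hγ0 k).le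
  linarith [hstep k]

theorem IsSaddle.sum_mul_of_achievesNash {L : ℝ} (hn : 0 < n) (hXc : IsClosed X)
    (hX : Convex ℝ X) (hYc : IsClosed Y) (hY : Convex ℝ Y)
    (hf : ∀ i, StrictlyConvexConcave (f i)) (hL : SubgradientBound X Y f L)
    (hγ : StepsizeRule γ)
    (hN : ∀ G : ℕ → WeightedDigraph n, UJSC G → WeightRule G → AchievesNash X Y f G γ)
    {a : E} {b : F} (hab : IsSaddle X Y (fun x y => ∑ i, f i x y) a b)
    {μ : Fin n → ℝ} (hμ : ∀ i, 0 < μ i) (hμ1 : ∑ i, μ i = 1) :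
    IsSaddle X Y (fun x y => ∑ i, μ i * f i x y) a b := by
  have hG := weightRule_ofVector hn μ hμ hμ1
  obtain ⟨x, y, h, hx, hy⟩ := exists_isTrajectory hXc hX hYc hY hf hab.1 hab.2.1
    (fun _ => WeightedDigraph.ofVector μ hμ) γ
  obtain ⟨a', b', hab', hxa, hyb⟩ := hN _ (uJSC_ofVector μ hμ) hG x y h
  obtain ⟨rfl, rfl⟩ := hab.unique hX hY (StrictlyConvexConcave.sum hn hf) hab'
  refine ⟨hab.1, hab.2.1, fun v hv => ?_, fun w hw => ?_⟩
  · have := h.neg_swap.sum_mul_le_of_tendsto hY (fun i => (hf i).neg_swap) hL.neg_swap hγ hμ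
      hμ1 hG hy hx hyb hxa hab.2.1 hv
    simpa using this
  · exact h.sum_mul_le_of_tendsto hX hf hL hγ hμ hμ1 hG hx hy hxa hyb hab.1 hw

/-- The `i`-th unit vector is not positive, but its mixtures with the uniform vector are; the weight
`t` of the latter tends to zero. -/
theorem apply_le_of_forall_sum_mul_le {g g' : Fin n → ℝ}
    (h : ∀ μ : Fin n → ℝ, (∀ i, 0 < μ i) → ∑ i, μ i = 1 → ∑ i, μ i * g i ≤ ∑ i, μ i * g' i)
    (i : Fin n) : g i ≤ g' i := by
  have hn : 0 < (n : ℝ) := Nat.cast_pos.2 i.pos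
  set S := ∑ j, (n : ℝ)⁻¹ * (g j - g' j)
  have key : ∀ t : ℝ, 0 < t → t < 1 → (1 - t) * (g i - g' i) + t * S ≤ 0 := by
    intro t ht0 ht1
    have := h (fun j => (1 - t) * (if j = i then 1 else 0) + t * (n : ℝ)⁻¹)
      (fun j => by
        have : 0 ≤ (1 - t) * (if j = i then (1 : ℝ) else 0) := by
          split_ifs <;> linarith
        positivity)
      (by simp [Finset.sum_add_distrib, hn.ne', mul_left_comm _ t])
    rw [← sub_nonpos, ← Finset.sum_sub_distrib] at this
    refine le_of_eq_of_le ?_ this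
    simp only [← mul_sub]
    simp only [add_mul, Finset.sum_add_distrib, S, Finset.mul_sum, mul_assoc]
    simp
  have hlim : Tendsto (fun t : ℝ => (1 - t) * (g i - g' i) + t * S) (𝓝[>] 0)
      (𝓝 ((1 - 0) * (g i - g' i) + 0 * S)) :=
    (Continuous.tendsto (by fun_prop) 0).mono_left nhdsWithin_le_nhds
  have := le_of_tendsto hlim (by
    filter_upwards [Ioo_mem_nhdsGT (show (0 : ℝ) < 1 from one_pos)] with t ht
    exact key t ht.1 ht.2)
  linarith

theorem exists_forall_isSaddle_of_achievesNash (hn : 0 < n) (hXc : IsClosed X)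
    (hX : Convex ℝ X) (hYc : IsClosed Y) (hY : Convex ℝ Y)
    (hf : ∀ i, StrictlyConvexConcave (f i)) (hsaddle : SaddlePointsExist X Y f)
    (hbounded : BoundedSubgradients X Y f) (hγ : StepsizeRule γ)
    (hN : ∀ G : ℕ → WeightedDigraph n, UJSC G → WeightRule G → AchievesNash X Y f G γ) :
    ∃ a b, ∀ i, IsSaddle X Y (f i) a b := by
  obtain ⟨L, -, hL⟩ := hbounded
  have hn' : (0 : ℝ) < n := Nat.cast_pos.2 hn
  -- Uniform weights provide a saddle point of the plain sum, the candidate for the common one.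
  obtain ⟨a, b, ha, hb, h1, h2⟩ := hsaddle (fun _ => (n : ℝ)⁻¹)
    ⟨fun _ => by positivity, by simp [hn'.ne']⟩
  have hab : IsSaddle X Y (fun x y => ∑ i, f i x y) a b := by
    simp only [← Finset.mul_sum] at h1 h2
    exact ⟨ha, hb, fun v hv => le_of_mul_le_mul_left (h1 v hv) (inv_pos.2 hn'),
      fun u hu => le_of_mul_le_mul_left (h2 u hu) (inv_pos.2 hn')⟩
  have key := fun (μ : Fin n → ℝ) (hμ : ∀ i, 0 < μ i) (hμ1 : ∑ i, μ i = 1) =>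
    IsSaddle.sum_mul_of_achievesNash hn hXc hX hYc hY hf hL hγ hN hab hμ hμ1
  exact ⟨a, b, fun i => ⟨ha, hb,
    fun v hv => apply_le_of_forall_sum_mul_le (g := fun i => f i a v) (g' := fun i => f i a b)
      (fun μ hμ hμ1 => (key μ hμ hμ1).2.2.1 v hv) i,
    fun u hu => apply_le_of_forall_sum_mul_le (g := fun i => f i a b) (g' := fun i => f i u b)
      (fun μ hμ hμ1 => (key μ hμ hμ1).2.2.2 u hu) i⟩⟩

end Necessity

theorem theorem3 {n m₁ m₂ : ℕ} (hn : 0 < n)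
    (X : Set (EuclideanSpace ℝ (Fin m₁))) (Y : Set (EuclideanSpace ℝ (Fin m₂)))
    (hXclosed : IsClosed X) (hXconvex : Convex ℝ X)
    (hYclosed : IsClosed Y) (hYconvex : Convex ℝ Y)
    (f : Fin n → EuclideanSpace ℝ (Fin m₁) → EuclideanSpace ℝ (Fin m₂) → ℝ)
    (hf : ∀ i, StrictlyConvexConcave (f i))
    (hsaddle : SaddlePointsExist X Y f)
    (hbounded : BoundedSubgradients X Y f)
    (γ : ℕ → ℝ) (hγ : StepsizeRule γ) :
    (∀ G : ℕ → WeightedDigraph n, UJSC G → WeightRule G → AchievesNash X Y f G γ) ↔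
      ∃ a b, ∀ i, IsSaddle X Y (f i) a b := by
  constructor
  · exact exists_forall_isSaddle_of_achievesNash hn hXclosed hXconvex hYclosed hYconvex hf hsaddle
      hbounded hγ
  · rintro ⟨a, b, hab⟩ G hU hG
    exact achievesNash_of_forall_isSaddle hXclosed hXconvex hYclosed hYconvex hn hf hbounded hU hG
      hγ hab
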